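/- Let $K$ be a field and let $m,n,d\ge 0$ be integers. Let $\mathbf a_1\prec\dots\prec\mathbf a_m$ be $m$ generic vectors with coordinates $\mathbf a_k=(x_{k1},\dots,x_{kn})$, and let $\mathcal B$ be their $n$-dimensional bracket algebra: the polynomial ring over $K$ in the symbols $[\mathbf b_1\cdots\mathbf b_n]$ ($\mathbf b_j\in\{\mathbf a_1,\dots,\mathbf a_m\}$) modulo the ideal of all polynomials that vanish in $K[x_{kj}]$ when each bracket is replaced by the determinant of its entries. A $d\times n$ tableau $T$ with entries in $\{\mathbf a_1,\dots,\mathbf a_m\}$ is identified with the bracket monomial in $\mathcal B$ that is the product of the brackets of its $d$ rows. It is *straight* if every row is strictly ascending and every column, read downwards, is non-descending. In the *negative column order*, $f\succ g$ (for $d\times n$ tableaux) means that $\mathrm{vec}(f)$ precedes $\mathrm{vec}(g)$ lexicographically, where $\mathrm{vec}$ lists the entries column by column, from left to right, each column from top to bottom. For $d\times n$ tableaux $T_1,T_2$ let $$\xi(T_1,T_2)=\sum_X \mathrm{rowsign}(X,T_1),$$ summed over all $d\times n$ tableaux $X$ such that, for each $i$, the $i$-th row of $X$ is a permutation of the $i$-th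 row of $T_1$ and, for each $j$, the $j$-th column of $X$ is a permutation of the $j$-th column of $T_2$; here $\mathrm{rowsign}(X,T_1)=\prod_{i=1}^d\delta_i$ with $\delta_i$ the sign of the permutation taking the $i$-th row of $T_1$ to the $i$-th row of $X$ (and $\delta_i=0$ if the $i$-th row of $T_1$ has a repeated entry). Let $T$ be a $d\times n$ tableau and let $T=\sum_{i=1}^k\lambda_iT_i$ in $\mathcal B$, with $\lambda_i\in K$ and straight $d\times n$ tableaux $T_1\succ T_2\succ\dots\succ T_k$ (zero coefficients are allowed). Then for all $i=1,\dots,k$ $$\lambda_i=\xi(T,T_i)-\sum_{j<i}\lambda_j\,\xi(T_j,T_i).$$ Moreover, if every row of $T$ is strictly ascending, then $k\ge 1$, and $\lambda_1=1$ whenever $\lambda_1\ne 0$; in particular $\lambda_1=1$ if $\sum\lambda_iT_i$ is the straight expression of $T$ with its zero terms omitted. -/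

import Mathlib

/-- A tableau with `d` rows and `n` columns whose entry `k : Fin m` stands for the vector `a_k`;
`T i` is the `i`-th row.  The vectors are ordered by `a_0 ≺ a_1 ≺ ⋯ ≺ a_{m-1}`. -/
abbrev Tableau (m n d : ℕ) : Type := Fin d → Fin n → Fin m

/-- The expanding map from the polynomial ring in the formal brackets `[a_{b 0} ⋯ a_{b (n-1)}]`
to the coordinate ring `K[x_{k,j}]`: each bracket goes to the determinant of the coordinates of
its entries, `a_k = (x_{k,0}, …, x_{k,n-1})`. -/
noncomputable def bracketExpansion (K : Type*) [Field K] (m n : ℕ) :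
    MvPolynomial (Fin n → Fin m) K →ₐ[K] MvPolynomial (Fin m × Fin n) K :=
  MvPolynomial.aeval fun b =>
    (Matrix.of fun r c : Fin n => (MvPolynomial.X (b r, c) : MvPolynomial (Fin m × Fin n) K)).det

/-- The bracket algebra: polynomials in the brackets modulo the ideal of all algebraic
dependences among the corresponding determinants. -/
abbrev BracketAlgebra (K : Type*) [Field K] (m n : ℕ) : Type _ :=
  MvPolynomial (Fin n → Fin m) K ⧸ RingHom.ker (bracketExpansion K m n)

namespace Tableau

variable {m n d : ℕ}

/-- The bracket monomial of a tableau: the product of the brackets of its rows. -/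
noncomputable def toBracket (K : Type*) [Field K] (T : Tableau m n d) : BracketAlgebra K m n :=
  Ideal.Quotient.mk (RingHom.ker (bracketExpansion K m n)) (∏ i, MvPolynomial.X (T i))

/-- Each row is (strictly) ascending. -/
def RowAscending (T : Tableau m n d) : Prop := ∀ i, StrictMono (T i)

/-- Straight (standard) tableaux: rows are ascending and columns are non-descending. -/
def IsStraight (T : Tableau m n d) : Prop :=
  T.RowAscending ∧ ∀ j, Monotone fun i => T i j

/-- The entries read column by column, each column from top to bottom: the index set is the
lexicographically ordered set of pairs (column, row). -/
def vec (T : Tableau m n d) : Fin n ×ₗ Fin d → Fin m :=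
  fun p => T (ofLex p).2 (ofLex p).1

/-- `f ≻ g` in the negative column order, for tableaux of the same degree `d`:
`vec f` precedes `vec g` lexicographically. -/
def NegColGT (f g : Tableau m n d) : Prop := toLex f.vec < toLex g.vec

/-- Each row of `X` is a permutation of the same row of `T`. -/
def RowsPermute (X T : Tableau m n d) : Prop :=
  ∀ i, ∃ σ : Equiv.Perm (Fin n), ∀ j, X i j = T i (σ j)

/-- Each column of `X` is a permutation of the same column of `T`. -/
def ColsPermute (X T : Tableau m n d) : Prop :=
  ∀ j, ∃ σ : Equiv.Perm (Fin d), ∀ i, X i j = T (σ i) j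

/-- The sign of the permutation taking row `i` of `T` to row `i` of `X`.  If the entries of
row `i` of `T` are distinct, the sum has exactly one term; if an entry is repeated
(so that the bracket vanishes), the sign is ambiguous, and the sum is `0`. -/
def rowPermSign (X T : Tableau m n d) (i : Fin d) : ℤ :=
  ∑ σ : Equiv.Perm (Fin n) with ∀ j, X i j = T i (σ j), (Equiv.Perm.sign σ : ℤ)

/-- The product over all rows of the signs of the row permutations from `T` to `X`. -/
def rowsign (X T : Tableau m n d) : ℤ := ∏ i, rowPermSign X T i

open Classical in
/-- `ξ(T₁, T₂)`: the sum of `rowsign(X, T₁)` over the tableaux `X` whose rows are permutations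
of the rows of `T₁` and whose columns are permutations of the columns of `T₂`. -/
noncomputable def xi (T₁ T₂ : Tableau m n d) : ℤ :=
  ∑ X : Tableau m n d with X.RowsPermute T₁ ∧ X.ColsPermute T₂, rowsign X T₁

end Tableau

/-- `T = ∑ i, c i • S i` in the bracket algebra, where the `S i` are straight tableaux listed
in strictly descending negative column order. -/
structure IsStraightExpression {K : Type*} [Field K] {m n d k : ℕ} (T : Tableau m n d)
    (c : Fin k → K) (S : Fin k → Tableau m n d) : Prop where
  straight : ∀ i, (S i).IsStraight
  descending : ∀ i j, i < j → (S i).NegColGT (S j)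
  eq_sum : T.toBracket K = ∑ i, c i • (S i).toBracket K

/-! Expanding every row determinant of `T` by Leibniz gives signed monomials `∏ x_{X i j, j}`, one
for each choice of row permutations. Two tableaux give the same monomial exactly when their columns
agree up to permutation, so `ξ(T, S)` is the coefficient of the monomial of `S`
(`coeff_bracketExpansion`), and `ξ(·, S)` is linear on the bracket algebra (`xi_eq_sum`). Permuting
ascending rows can only move the column-sorted form later in column order
(`RowAscending.eq_or_negColGT`). Hence `ξ` is unitriangular on straight tableaux, and the recursion
is forward substitution. For the leading coefficient, let `T'` be the column-sorted form of `T`.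
Since `ξ(T, T') = 1`, some `S j` does not come after `T'`; if `c 0 = ξ(T, S 0) ≠ 0`, then `S 0` does
not come before `T'`. So `S 0 = T'` and `c 0 = 1`. -/

/-! ### Sorting tuples -/

/-- A permutation of `Fin d` cannot map all of `{0, …, i}` strictly below `i`. -/
theorem Equiv.Perm.exists_le_le_apply {d : ℕ} (π : Equiv.Perm (Fin d)) (i : Fin d) :
    ∃ k ≤ i, i ≤ π k := by
  by_contra! H
  have h : (Finset.Iic i).card ≤ (Finset.Iio i).card :=
    Finset.card_le_card_of_injOn π (by simpa [Set.MapsTo] using H) π.injective.injOn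
  simp at h

section Sorting

variable {α : Type*} [LinearOrder α] {d : ℕ} {f g f' g' : Fin d → α}

/-- Entries of the sorted rearrangements `f'`, `g'` of `f`, `g` compare through corresponding
entries of `f` and `g`. -/
theorem exists_le_and_le_of_monotone_rearrangement (hf' : Monotone f') (hg' : Monotone g')
    (hf : ∃ σ : Equiv.Perm (Fin d), ∀ i, f i = f' (σ i))
    (hg : ∃ σ : Equiv.Perm (Fin d), ∀ i, g i = g' (σ i)) (i : Fin d) :
    ∃ l, f' i ≤ f l ∧ g l ≤ g' i := by
  obtain ⟨σ, hσ⟩ := hf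
  obtain ⟨τ, hτ⟩ := hg
  obtain ⟨k, hk, hik⟩ := Equiv.Perm.exists_le_le_apply (τ.symm.trans σ) i
  refine ⟨τ.symm k, ?_, ?_⟩
  · rw [hσ]
    exact hf' hik
  · rw [hτ, Equiv.apply_symm_apply]
    exact hg' hk

theorem le_of_monotone_rearrangement (hf' : Monotone f') (hg' : Monotone g')
    (hf : ∃ σ : Equiv.Perm (Fin d), ∀ i, f i = f' (σ i))
    (hg : ∃ σ : Equiv.Perm (Fin d), ∀ i, g i = g' (σ i)) (h : ∀ i, f i ≤ g i) (i : Fin d) :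
    f' i ≤ g' i := by
  obtain ⟨l, h₁, h₂⟩ := exists_le_and_le_of_monotone_rearrangement hf' hg' hf hg i
  exact h₁.trans ((h l).trans h₂)

theorem lt_of_monotone_rearrangement (hf' : Monotone f') (hg' : Monotone g')
    (hf : ∃ σ : Equiv.Perm (Fin d), ∀ i, f i = f' (σ i))
    (hg : ∃ σ : Equiv.Perm (Fin d), ∀ i, g i = g' (σ i)) (h : ∀ i, f i < g i) (i : Fin d) :
    f' i < g' i := by
  obtain ⟨l, h₁, h₂⟩ := exists_le_and_le_of_monotone_rearrangement hf' hg' hf hg i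
  exact h₁.trans_lt ((h l).trans_le h₂)

end Sorting

/-- Pointwise comparable tuples that are rearrangements of the same tuple are equal. -/
theorem eq_of_le_of_rearrangement {m d : ℕ} {f g s : Fin d → Fin m}
    (hf : ∃ σ : Equiv.Perm (Fin d), ∀ i, f i = s (σ i))
    (hg : ∃ σ : Equiv.Perm (Fin d), ∀ i, g i = s (σ i)) (h : ∀ i, f i ≤ g i) (i : Fin d) :
    f i = g i := by
  obtain ⟨σ, hσ⟩ := hf
  obtain ⟨τ, hτ⟩ := hg
  -- Rearrangements have equal sums, so no termwise inequality can be strict.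
  have hsum : ∑ i, (f i : ℕ) = ∑ i, (g i : ℕ) := by
    simp only [hσ, hτ]
    rw [Equiv.sum_comp σ fun i => (s i : ℕ), Equiv.sum_comp τ fun i => (s i : ℕ)]
  exact Fin.ext
    ((Finset.sum_eq_sum_iff_of_le fun i _ => Fin.le_def.1 (h i)).1 hsum i (Finset.mem_univ i))

namespace Tableau

/-! ### Combinatorics of tableaux -/

section Combinatorics

variable {m n d : ℕ}

theorem ColsPermute.refl (T : Tableau m n d) : T.ColsPermute T := fun _ => ⟨1, fun _ => rfl⟩

theorem ColsPermute.symm {X T : Tableau m n d} (h : X.ColsPermute T) : T.ColsPermute X := by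
  intro j
  obtain ⟨σ, hσ⟩ := h j
  exact ⟨σ.symm, fun i => by rw [hσ, Equiv.apply_symm_apply]⟩

/-- Sorting the columns of a tableau with ascending rows gives a straight tableau. -/
theorem RowAscending.exists_isStraight {T : Tableau m n d} (hT : T.RowAscending) :
    ∃ T' : Tableau m n d, T'.IsStraight ∧ T.ColsPermute T' := by
  let T' : Tableau m n d := fun i j => T (Tuple.sort (fun r => T r j) i) j
  have hmono (j : Fin n) : Monotone fun i => T' i j := Tuple.monotone_sort fun r => T r j
  have hcols : T.ColsPermute T' :=
    ColsPermute.symm fun j => ⟨Tuple.sort fun r => T r j, fun _ => rfl⟩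
  exact ⟨T', ⟨fun i j l hjl => lt_of_monotone_rearrangement (hmono j) (hmono l) (hcols j)
    (hcols l) (fun r => hT r hjl) i, hmono⟩, hcols⟩

/-- If the rows of `T` are ascending, a row permutation agreeing with `T` in the columns before
`j` dominates `T` in column `j`. -/
theorem RowAscending.le_of_rowsPermute {X T : Tableau m n d} (hT : T.RowAscending)
    (hX : X.RowsPermute T) {j : Fin n} (hj : ∀ l < j, ∀ i, X i l = T i l) (i : Fin d) :
    T i j ≤ X i j := by
  obtain ⟨σ, hσ⟩ := hX i
  have hfix (l : Fin n) (hl : l < j) : σ l = l :=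
    (hT i).injective (by rw [← hσ, hj l hl])
  rw [hσ]
  -- `σ` fixes every column before `j`, so by injectivity it cannot send `j` to one of them.
  refine (hT i).monotone (not_lt.1 fun hlt => ?_)
  exact hlt.ne (σ.injective (hfix _ hlt))

/-- The column-sorted form `T'` of a tableau `T` with ascending rows is the first, in column
order, of the column-sorted forms `S` of the row permutations `X` of `T`, and only `X = T`
attains it. -/
theorem RowAscending.eq_or_negColGT {T T' X S : Tableau m n d} (hT : T.RowAscending)
    (hT' : ∀ j, Monotone fun i => T' i j) (hTT' : T.ColsPermute T')
    (hS : ∀ j, Monotone fun i => S i j) (hXT : X.RowsPermute T) (hXS : X.ColsPermute S) :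
    (X = T ∧ S = T') ∨ T'.NegColGT S := by
  have hcol {j : Fin n} (hj : ∀ i, X i j = T i j) (i : Fin d) : S i j = T' i j :=
    le_antisymm
      (le_of_monotone_rearrangement (hS j) (hT' j) (hXS j) (hTT' j) (fun r => (hj r).le) i)
      (le_of_monotone_rearrangement (hT' j) (hS j) (hTT' j) (hXS j) (fun r => (hj r).ge) i)
  by_cases hall : ∀ j i, X i j = T i j
  · exact Or.inl ⟨by ext i j : 2; exact hall j i, by ext i j : 2; exact hcol (hall j) i⟩
  right
  push Not at hall
  obtain ⟨j, hj, hjmin⟩ := WellFounded.has_min (wellFounded_lt (α := Fin n))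
    {j | ∃ i, X i j ≠ T i j} hall
  have hlow (l : Fin n) (hl : l < j) (i : Fin d) : X i l = T i l := by
    by_contra hne
    exact hjmin l ⟨i, hne⟩ hl
  have hdom := hT.le_of_rowsPermute hXT hlow
  have hne : ∃ i, T' i j ≠ S i j := by
    by_contra! heq
    obtain ⟨i, hi⟩ := hj
    have hX : ∃ σ : Equiv.Perm (Fin d), ∀ i, X i j = T' (σ i) j := by
      obtain ⟨σ, hσ⟩ := hXS j
      exact ⟨σ, fun r => by rw [hσ, heq]⟩
    exact hi (eq_of_le_of_rearrangement (f := fun i => T i j) (g := fun i => X i j)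
      (s := fun i => T' i j) (hTT' j) hX hdom i).symm
  -- The sorted forms agree in all columns before `j`, so `(j, i)` is the first position where `T'`
  -- and `S` differ.
  obtain ⟨i, hi, himin⟩ := WellFounded.has_min (wellFounded_lt (α := Fin d))
    {i | T' i j ≠ S i j} hne
  refine ⟨toLex (j, i), fun p hp => ?_, lt_of_le_of_ne
    (le_of_monotone_rearrangement (hT' j) (hS j) (hTT' j) (hXS j) hdom i) hi⟩
  change T' (ofLex p).2 (ofLex p).1 = S (ofLex p).2 (ofLex p).1
  rcases Prod.Lex.lt_iff.1 hp with hlt | ⟨heq, hlt⟩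
  · exact (hcol (hlow _ hlt) _).symm
  · change (ofLex p).1 = j at heq
    rw [heq]
    by_contra hne
    exact himin _ hne hlt

theorem rowsign_self {T : Tableau m n d} (hT : T.RowAscending) : T.rowsign T = 1 := by
  refine Finset.prod_eq_one fun i _ => ?_
  have : (Finset.univ.filter fun σ : Equiv.Perm (Fin n) => ∀ j, T i j = T i (σ j)) = {1} := by
    ext σ
    simp [(hT i).injective.eq_iff, Equiv.ext_iff, eq_comm]
  rw [rowPermSign, this]
  simp

theorem xi_eq_one {T T' : Tableau m n d} (hT : T.RowAscending)
    (hT' : ∀ j, Monotone fun i => T' i j) (hTT' : T.ColsPermute T') : T.xi T' = 1 := by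
  classical
  rw [xi, Finset.sum_eq_single T, rowsign_self hT]
  · intro X hX hne
    obtain ⟨hXT, hXT'⟩ := (Finset.mem_filter.1 hX).2
    rcases hT.eq_or_negColGT hT' hTT' hT' hXT hXT' with h | h
    · exact absurd h.1 hne
    · exact absurd h (lt_irrefl _)
  · intro h
    exact absurd (Finset.mem_filter.2 ⟨Finset.mem_univ T, fun _ => ⟨1, fun _ => rfl⟩, hTT'⟩) h

theorem xi_self {T : Tableau m n d} (hT : T.IsStraight) : T.xi T = 1 :=
  xi_eq_one hT.1 hT.2 (ColsPermute.refl T)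

theorem eq_or_negColGT_of_xi_ne_zero {T T' S : Tableau m n d} (hT : T.RowAscending)
    (hT' : ∀ j, Monotone fun i => T' i j) (hTT' : T.ColsPermute T')
    (hS : ∀ j, Monotone fun i => S i j) (h : T.xi S ≠ 0) : S = T' ∨ T'.NegColGT S := by
  classical
  obtain ⟨X, hX, -⟩ := Finset.exists_ne_zero_of_sum_ne_zero h
  obtain ⟨hXT, hXS⟩ := (Finset.mem_filter.1 hX).2
  exact (hT.eq_or_negColGT hT' hTT' hS hXT hXS).imp_left And.right

/-- `ξ` is unitriangular on straight tableaux. -/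
theorem xi_eq_zero_of_negColGT {T S : Tableau m n d} (hT : T.IsStraight) (hS : S.IsStraight)
    (h : S.NegColGT T) : T.xi S = 0 := by
  by_contra hne
  rcases eq_or_negColGT_of_xi_ne_zero hT.1 hT.2 (ColsPermute.refl T) hS.2 hne with rfl | h'
  · exact lt_irrefl _ h
  · exact lt_asymm h h'

/-- This is the indexing of the Leibniz expansion. If a row has repeated entries, several tuples `p`
yield the same `X`, and their signs add up as in `rowPermSign`. -/
theorem xi_eq_sum_perm (T S : Tableau m n d) [DecidablePred fun X => ColsPermute X S] :
    T.xi S = ∑ p : Fin d → Equiv.Perm (Fin n),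
      if ColsPermute (fun i j => T i (p i j)) S then ∏ i, (Equiv.Perm.sign (p i) : ℤ) else 0 := by
  classical
  have hrow (X : Tableau m n d) : X.rowsign T = ∑ p : Fin d → Equiv.Perm (Fin n),
      if X = (fun i j => T i (p i j)) then ∏ i, (Equiv.Perm.sign (p i) : ℤ) else 0 := by
    simp only [rowsign, rowPermSign, Finset.sum_filter, Finset.prod_univ_sum,
      Fintype.piFinset_univ]
    refine Finset.sum_congr rfl fun p _ => ?_
    split_ifs with h
    · exact Finset.prod_congr rfl fun i _ => if_pos fun j => by rw [h]
    · obtain ⟨i, hi⟩ : ∃ i, ¬ ∀ j, X i j = T i (p i j) := by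
        by_contra! H
        exact h (by ext i j : 2; exact H i j)
      exact Finset.prod_eq_zero (Finset.mem_univ i) (if_neg hi)
  have hterm (X : Tableau m n d) :
      (if X.RowsPermute T ∧ X.ColsPermute S then X.rowsign T else 0) =
        ∑ p : Fin d → Equiv.Perm (Fin n), if X = (fun i j => T i (p i j)) then
          (if X.ColsPermute S then ∏ i, (Equiv.Perm.sign (p i) : ℤ) else 0) else 0 := by
    by_cases h : X.RowsPermute T ∧ X.ColsPermute S
    · simp only [h, hrow, and_self, if_true]
    · rw [if_neg h]
      refine (Finset.sum_eq_zero fun p _ => ?_).symm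
      rw [← ite_and, if_neg]
      rintro ⟨rfl, hS⟩
      exact h ⟨fun i => ⟨p i, fun _ => rfl⟩, hS⟩
  rw [xi, Finset.sum_filter]
  refine (Finset.sum_congr rfl fun X _ => Eq.trans (by congr) (hterm X)).trans ?_
  rw [Finset.sum_comm]
  refine Finset.sum_congr rfl fun p _ => ?_
  rw [Finset.sum_ite_eq' Finset.univ fun i j => T i (p i j), if_pos (Finset.mem_univ _)]

end Combinatorics

/-! ### `ξ` as a coefficient -/

section Expansion

variable {m n d : ℕ}

/-- The exponent of the monomial `∏ x_{S i j, j}`, the column content of `S`. -/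
noncomputable def content (S : Tableau m n d) : Fin m × Fin n →₀ ℕ :=
  ∑ i, ∑ j, Finsupp.single (S i j, j) 1

theorem content_apply (S : Tableau m n d) (v : Fin m) (j : Fin n) :
    S.content (v, j) = Fintype.card {i // S i j = v} := by
  classical
  have h (i : Fin d) : (∑ l, Finsupp.single (S i l, l) (1 : ℕ)) (v, j) =
      if S i j = v then 1 else 0 := by
    rw [Finsupp.finsetSum_apply, Finset.sum_eq_single j]
    · simp [Finsupp.single_apply, eq_comm]
    · intro l _ hl
      simp [hl]
    · simp
  rw [content, Finsupp.finsetSum_apply, Fintype.card_subtype, Finset.card_filter]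
  simp only [h]

theorem content_eq_content_iff {X S : Tableau m n d} :
    X.content = S.content ↔ X.ColsPermute S := by
  simp only [Finsupp.ext_iff, Prod.forall, content_apply]
  rw [forall_comm]
  refine forall_congr' fun j => ?_
  constructor
  · intro h
    let e (v : Fin m) : {i // X i j = v} ≃ {i // S i j = v} := Fintype.equivOfCardEq (h v)
    -- Bijections between the fibres over each value `v` glue to a permutation of the rows.
    exact ⟨Equiv.ofFiberEquiv e, fun i => (Equiv.ofFiberEquiv_map e i).symm⟩
  · rintro ⟨σ, hσ⟩ v
    exact Fintype.card_congr (σ.subtypeEquiv fun i => by rw [hσ])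

theorem prod_bracketExpansion (K : Type*) [Field K] (T : Tableau m n d) :
    bracketExpansion K m n (∏ i, MvPolynomial.X (T i)) =
      ∑ p : Fin d → Equiv.Perm (Fin n),
        MvPolynomial.monomial (content fun i j => T i (p i j))
          (((∏ i, (Equiv.Perm.sign (p i) : ℤ) : ℤ)) : K) := by
  classical
  simp only [map_prod, bracketExpansion, MvPolynomial.aeval_X, Matrix.det_apply',
    Matrix.of_apply, Finset.prod_univ_sum, Fintype.piFinset_univ, Finset.prod_mul_distrib]
  refine Finset.sum_congr rfl fun p _ => ?_
  rw [content, ← mul_one ((∏ i, (Equiv.Perm.sign (p i) : ℤ) : ℤ) : K),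
    ← MvPolynomial.C_mul_monomial, MvPolynomial.monomial_sum_one]
  simp only [MvPolynomial.monomial_sum_one, MvPolynomial.X]
  simp

theorem coeff_bracketExpansion (K : Type*) [Field K] (T S : Tableau m n d) :
    (bracketExpansion K m n (∏ i, MvPolynomial.X (T i))).coeff S.content = (T.xi S : K) := by
  classical
  rw [prod_bracketExpansion, MvPolynomial.coeff_sum, xi_eq_sum_perm, Int.cast_sum]
  refine Finset.sum_congr rfl fun p _ => ?_
  rw [MvPolynomial.coeff_monomial]
  simp only [content_eq_content_iff]
  split_ifs <;> simp

end Expansion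

end Tableau

/-! ### Solving the triangular system for the coefficients -/

namespace IsStraightExpression

variable {K : Type*} [Field K] {m n d k : ℕ} {T : Tableau m n d} {c : Fin k → K}
  {S : Fin k → Tableau m n d}

/-- `ξ(·, U)` is well defined and linear on the bracket algebra. -/
theorem xi_eq_sum (h : IsStraightExpression T c S) (U : Tableau m n d) :
    (T.xi U : K) = ∑ j, c j * ((S j).xi U : K) := by
  have hmk (V : Tableau m n d) : Ideal.kerLiftAlg (bracketExpansion K m n) (V.toBracket K) =
      bracketExpansion K m n (∏ i, MvPolynomial.X (V i)) := Ideal.kerLiftAlg_mk _ _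
  have hE := congrArg (fun q => (Ideal.kerLiftAlg (bracketExpansion K m n) q).coeff U.content)
    h.eq_sum
  simpa only [map_sum, map_smul, hmk, MvPolynomial.coeff_sum, MvPolynomial.coeff_smul,
    Tableau.coeff_bracketExpansion, smul_eq_mul] using hE

theorem coeff_eq (h : IsStraightExpression T c S) (i : Fin k) :
    c i = (T.xi (S i) : K) - ∑ j ∈ Finset.Iio i, c j * ((S j).xi (S i) : K) := by
  rw [h.xi_eq_sum (S i), eq_sub_iff_add_eq]
  have hsub : ∑ j ∈ Finset.Iic i, c j * ((S j).xi (S i) : K) =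
      ∑ j, c j * ((S j).xi (S i) : K) := by
    refine Finset.sum_subset (Finset.subset_univ _) fun j _ hj => ?_
    have hij : i < j := by simpa using hj
    rw [Tableau.xi_eq_zero_of_negColGT (h.straight j) (h.straight i) (h.descending i j hij)]
    simp
  rw [← hsub, ← Finset.Iio_insert, Finset.sum_insert (by simp),
    Tableau.xi_self (h.straight i)]
  simp

/-- A straight expression of a tableau with ascending rows has a term that does not come after
the column-sorted form of the tableau. -/
theorem exists_eq_or_negColGT (h : IsStraightExpression T c S) (hT : T.RowAscending) {T' : Tableau m n d}
    (hT' : T'.IsStraight) (hTT' : T.ColsPermute T') :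
    ∃ j, S j = T' ∨ (S j).NegColGT T' := by
  have hsum := h.xi_eq_sum T'
  rw [Tableau.xi_eq_one hT hT'.2 hTT', Int.cast_one] at hsum
  obtain ⟨j, -, hj⟩ := Finset.exists_ne_zero_of_sum_ne_zero (hsum ▸ one_ne_zero)
  have hxi : (S j).xi T' ≠ 0 := fun h0 => hj (by simp [h0])
  exact ⟨j, (Tableau.eq_or_negColGT_of_xi_ne_zero (h.straight j).1 (h.straight j).2
    (Tableau.ColsPermute.refl _) hT'.2 hxi).imp_left Eq.symm⟩

theorem head_coeff_eq_one (h : IsStraightExpression T c S) (hT : T.RowAscending) :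
    ∃ hk : 0 < k, c ⟨0, hk⟩ ≠ 0 → c ⟨0, hk⟩ = 1 := by
  obtain ⟨T', hT', hTT'⟩ := hT.exists_isStraight
  obtain ⟨j, hj⟩ := h.exists_eq_or_negColGT hT hT' hTT'
  have hk : 0 < k := j.pos
  refine ⟨hk, fun hc => ?_⟩
  have hc0 : c ⟨0, hk⟩ = (T.xi (S ⟨0, hk⟩) : K) := by
    have hempty : Finset.Iio (⟨0, hk⟩ : Fin k) = ∅ :=
      Finset.eq_empty_of_forall_notMem fun l hl =>
        Nat.not_lt_zero _ (Fin.lt_def.1 (Finset.mem_Iio.1 hl))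
    simpa [hempty] using h.coeff_eq ⟨0, hk⟩
  have hxi : T.xi (S ⟨0, hk⟩) ≠ 0 := fun h0 => hc (by rw [hc0, h0, Int.cast_zero])
  rcases Tableau.eq_or_negColGT_of_xi_ne_zero hT hT'.2 hTT' (h.straight _).2 hxi with heq | hlt
  · rw [hc0, heq, Tableau.xi_eq_one hT hT'.2 hTT', Int.cast_one]
  · exfalso
    have h0j : (⟨0, hk⟩ : Fin k) = j ∨ (S ⟨0, hk⟩).NegColGT (S j) :=
      (Nat.eq_zero_or_pos (j : ℕ)).imp (fun hz => Fin.ext hz.symm)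
        (fun hpos => h.descending _ _ hpos)
    -- `S 0` comes first in the list, so if it lies after `T'`, so does every `S j`.
    have hT'j : T'.NegColGT (S j) := by
      rcases h0j with h0 | h0
      · exact h0 ▸ hlt
      · exact lt_trans hlt h0
    rcases hj with hj | hj
    · rw [hj] at hT'j
      exact lt_irrefl _ hT'j
    · exact lt_asymm hj hT'j

end IsStraightExpression

theorem mainTheorem2 {K : Type*} [Field K] {m n d k : ℕ} (T : Tableau m n d)
    (c : Fin k → K) (S : Fin k → Tableau m n d) (h : IsStraightExpression T c S) :
    (∀ i, c i = (T.xi (S i) : K) - ∑ j ∈ Finset.Iio i, c j * ((S j).xi (S i) : K)) ∧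
    (T.RowAscending → ∃ hk : 0 < k, c ⟨0, hk⟩ ≠ 0 → c ⟨0, hk⟩ = 1) :=
  ⟨h.coeff_eq, h.head_coeff_eq_one⟩
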